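/- Let $2\le n\le 9$, $\eta\in[0,1]$, and $\psi(b,t)=|b|^2+\eta\,(b\cdot t)^2$ for $b\in\mathbb Z^n$ and $t\in S^{n-1}$, the unit sphere of $\mathbb R^n$. Let $B$ be the open ball of radius $1/2$ centred at $0$ in $\mathbb R^n$. The $\mathcal H^1$-elliptic envelope $\bar\psi(b,t)$ of $\psi$ is the infimum of $$\int_\gamma \psi(\theta,\tau)\,d\mathcal H^1\in[0,\infty]$$ over all matrix-valued measures $\mu=\theta\otimes\tau\,\mathcal H^1\llcorner\gamma$ on $B$, where $\gamma\subset B$ is a $1$-rectifiable set with unit tangent vector $\tau:\gamma\to S^{n-1}$ and $\theta:\gamma\to\mathbb Z^n$ is $\mathcal H^1$-integrable, such that $\mu$ is divergence free in $B$, that is, $\int_\gamma \theta\,(\nabla\zeta\cdot\tau)\,d\mathcal H^1=0$ for all $\zeta\in C_c^\infty(B)$, and such that the support of $\mu-b\otimes t\,\mathcal H^1\llcorner(\mathbb R t\cap B)$ is a compact subset of $B$. Then $$\bar\psi(\beta e_i,t)=|\beta|\,\psi(e_i,t)\qquad\text{for all } i\in\{1,\dots,n\},\ \beta\in\mathbb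 Z,\ t\in S^{n-1},$$ where $e_1,\dots,e_n$ is the standard basis of $\mathbb Z^n$. -/

import Mathlib

open MeasureTheory Filter Topology
open scoped ENNReal ContDiff

noncomputable section

/-- The integer vector `b`, regarded as a vector with the Euclidean norm. -/
def intVec {m : ℕ} (b : Fin m → ℤ) : EuclideanSpace ℝ (Fin m) :=
  WithLp.toLp 2 fun i => (b i : ℝ)

/-- `γ ⊆ ℝⁿ` is `1`-rectifiable: it is `ℋ¹`-measurable, has finite `ℋ¹`-measure, and is covered,
up to an `ℋ¹`-null set, by countably many Lipschitz curves. -/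
def IsOneRectifiable {n : ℕ} (γ : Set (EuclideanSpace ℝ (Fin n))) : Prop :=
  NullMeasurableSet γ (μH[1]) ∧ μH[1] γ < ⊤ ∧
    ∃ f : ℕ → ℝ → EuclideanSpace ℝ (Fin n),
      (∀ k, ∃ K, LipschitzWith K (f k)) ∧ μH[1] (γ \ ⋃ k, Set.range (f k)) = 0

/-- The line `ℝ v` is the approximate tangent line of `γ` at `x`: the upper density of `γ` at `x`
is positive, and the part of `γ` outside any open cone `{y | dist (y - x, ℝ v) < s |y - x|}`
around `x + ℝ v` has density zero at `x`. -/
def IsApproxTangent {n : ℕ} (γ : Set (EuclideanSpace ℝ (Fin n)))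
    (x v : EuclideanSpace ℝ (Fin n)) : Prop :=
  0 < limsup (fun r : ℝ => μH[1] (γ ∩ Metric.closedBall x r) / ENNReal.ofReal r) (𝓝[>] 0) ∧
    ∀ s : ℝ, 0 < s →
      Tendsto (fun r : ℝ =>
        μH[1] (γ ∩ Metric.closedBall x r ∩
          {y | s * ‖y - x‖ ≤
            Metric.infDist (y - x) (Submodule.span ℝ {v} : Set (EuclideanSpace ℝ (Fin n)))}) /
          ENNReal.ofReal r) (𝓝[>] 0) (𝓝 0)

/-- The data of a measure `θ ⊗ τ ℋ¹⌞γ` (a rectifiable `1`-current) in `Ω ⊆ ℝⁿ` with multiplicity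
in `ℤᵐ`. As `|θ| ≥ 1` where `θ ≠ 0`, integrability of `θ` makes `γ ∩ {θ ≠ 0}` of finite length,
so that a carrier `γ` of finite length is no restriction on the measure. -/
structure RectCurrent (m n : ℕ) (Ω : Set (EuclideanSpace ℝ (Fin n))) where
  /-- the rectifiable set `γ` -/
  carrier : Set (EuclideanSpace ℝ (Fin n))
  /-- the multiplicity `θ` (only its values on `γ` matter) -/
  mult : EuclideanSpace ℝ (Fin n) → Fin m → ℤ
  /-- the unit tangent vector `τ` (only its values on `γ` matter) -/
  tangent : EuclideanSpace ℝ (Fin n) → EuclideanSpace ℝ (Fin n)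
  carrier_subset : carrier ⊆ Ω
  rectifiable : IsOneRectifiable carrier
  integrable_mult : Integrable (fun x => intVec (mult x)) ((μH[1]).restrict carrier)
  aemeasurable_tangent : AEMeasurable tangent ((μH[1]).restrict carrier)
  tangent_spec : ∀ᵐ x ∂((μH[1]).restrict carrier),
    ‖tangent x‖ = 1 ∧ IsApproxTangent carrier x (tangent x)

/-- The `m × n`-matrix-valued measure `θ ⊗ τ ℋ¹⌞γ` on `ℝⁿ`. A matrix is given by its `m` rows;
the `i`-th row of `θ ⊗ τ` is `θᵢ τ`. -/
def tensorMeasure {m n : ℕ} (γ : Set (EuclideanSpace ℝ (Fin n)))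
    (θ : EuclideanSpace ℝ (Fin n) → Fin m → ℤ)
    (τ : EuclideanSpace ℝ (Fin n) → EuclideanSpace ℝ (Fin n)) :
    VectorMeasure (EuclideanSpace ℝ (Fin n)) (Fin m → EuclideanSpace ℝ (Fin n)) :=
  ((μH[1]).restrict γ).withDensityᵥ fun x i => (θ x i : ℝ) • τ x

/-- The support of a vector-valued measure: the complement of the largest open set on all of whose
measurable subsets the measure vanishes. -/
def vectorSupport {X V : Type*} [TopologicalSpace X] [MeasurableSpace X]
    [AddCommMonoid V] [TopologicalSpace V] (μ : VectorMeasure X V) : Set X :=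
  {x | ∀ U ∈ 𝓝 x, ∃ A ⊆ U, MeasurableSet A ∧ μ A ≠ 0}

namespace RectCurrent

variable {m n : ℕ} {Ω : Set (EuclideanSpace ℝ (Fin n))}

/-- The measure `θ ⊗ τ ℋ¹⌞γ`. -/
def toMeasure (T : RectCurrent m n Ω) :
    VectorMeasure (EuclideanSpace ℝ (Fin n)) (Fin m → EuclideanSpace ℝ (Fin n)) :=
  tensorMeasure T.carrier T.mult T.tangent

/-- `T` is divergence free (closed) in `Ω`: for `μ = θ ⊗ τ ℋ¹⌞γ`, all `ζ ∈ C_c^∞(Ω)` and all `i`,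
`∑ⱼ ∫ ∂ⱼζ dμᵢⱼ = ∫_γ θᵢ (∇ζ · τ) dℋ¹ = 0`. -/
def DivFree (T : RectCurrent m n Ω) : Prop :=
  ∀ ζ : EuclideanSpace ℝ (Fin n) → ℝ, ContDiff ℝ ∞ ζ → HasCompactSupport ζ → tsupport ζ ⊆ Ω →
    ∀ i : Fin m, ∫ x in T.carrier, (T.mult x i : ℝ) * fderiv ℝ ζ x (T.tangent x) ∂μH[1] = 0

/-- The energy `∫_γ ψ(θ, τ) dℋ¹ ∈ [0, ∞]` of a nonnegative density `ψ`. -/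
def energy (ψ : (Fin m → ℤ) → EuclideanSpace ℝ (Fin n) → ℝ) (T : RectCurrent m n Ω) : ℝ≥0∞ :=
  ∫⁻ x in T.carrier, ENNReal.ofReal (ψ (T.mult x) (T.tangent x)) ∂μH[1]

end RectCurrent

/-- The `ℋ¹`-elliptic envelope `ψ̄(b, t)`: the infimum of the energies of the divergence-free
measures `μ = θ ⊗ τ ℋ¹⌞γ` in the open ball `B` of radius `1/2` around `0` for which
`supp (μ - b ⊗ t ℋ¹⌞(ℝ t ∩ B)) ⊆ B`. The support is taken in `ℝⁿ`, so that it is a compact subset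
of `B`. -/
def hOneEnvelope {m n : ℕ} (ψ : (Fin m → ℤ) → EuclideanSpace ℝ (Fin n) → ℝ)
    (b : Fin m → ℤ) (t : EuclideanSpace ℝ (Fin n)) : ℝ≥0∞ :=
  ⨅ (T : RectCurrent m n (Metric.ball 0 (1 / 2))) (_ : T.DivFree)
    (_ : vectorSupport (T.toMeasure -
        tensorMeasure
          ((Submodule.span ℝ {t} : Set (EuclideanSpace ℝ (Fin n))) ∩ Metric.ball 0 (1 / 2))
          (fun _ => b) (fun _ => t)) ⊆ Metric.ball 0 (1 / 2)),
    T.energy ψ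

/-- The line-energy density `ψ(b, t) = |b|² + η (b · t)²`. -/
def cubicDensity {n : ℕ} (η : ℝ) (b : Fin n → ℤ) (t : EuclideanSpace ℝ (Fin n)) : ℝ :=
  ‖intVec b‖ ^ 2 + η * (inner ℝ (intVec b) t) ^ 2

end

/-! Upper bound. A line of multiplicity `β e_i` can be split inside the ball into `|β|` nearly
parallel curves of multiplicity `sign β · e_i`. These are tents over the line, of slopes `k ε`,
leaving it at distance `ε` from the sphere and meeting only there. As `ε → 0` each tent tends in
length and direction to the diameter, which has length 1, so the energy tends to `|β| ψ(e_i, t)`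
(`hOneEnvelope_nsmul_le`).

Lower bound, by calibration. A divergence-free `μ` that agrees with the line measure near the sphere
has the same total mass as that measure, so `∫ θ_i (a · τ) = b_i (a · t)` for every constant vector
`a` (`RectCurrent.integral_mult_inner_tangent`). Take for `a` the gradient at `t` of the
1-homogeneous extension of `x ↦ 1 + η x_i²`; then `a · t = 1 + η t_i²`. It remains to show `|θ_i (a
· x)| ≤ ψ(θ, x)` for unit `x` (`mul_inner_cubicCalibration_le_cubicDensity`). If `θ` is a multiple
of `e_i`, this follows from `|θ_i| ≤ θ_i²` and `|a · x| ≤ 1 + η x_i²`. Otherwise another component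
is nonzero, and `|a| ≤ 2` gives `2 |θ_i| ≤ θ_i² + 1 ≤ |θ|²`. Both cases use `η ≤ 1` and the
integrality of `θ`. -/

/-! ### Lines parametrised by arc length -/

section LinePath

variable {E : Type*} [NormedAddCommGroup E] [NormedSpace ℝ E]

/-- The line through `p` with velocity `v`. -/
def linePath (p v : E) (s : ℝ) : E := p + s • v

theorem isometry_linePath (p : E) {v : E} (hv : ‖v‖ = 1) : Isometry (linePath p v) := by
  refine Isometry.of_dist_eq fun s r => ?_
  rw [linePath, linePath, dist_add_left, dist_eq_norm, ← sub_smul, norm_smul, hv, mul_one,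
    Real.dist_eq, Real.norm_eq_abs]

theorem continuous_linePath (p v : E) : Continuous (linePath p v) := by
  unfold linePath; fun_prop

theorem span_inter_ball_eq_linePath_image {t : E} (ht : ‖t‖ = 1) (R : ℝ) :
    (Submodule.span ℝ {t} : Set E) ∩ Metric.ball 0 R = linePath 0 t '' Set.Ioo (-R) R := by
  ext x
  constructor
  · rintro ⟨hx, hR⟩
    obtain ⟨s, rfl⟩ := Submodule.mem_span_singleton.1 hx
    rw [mem_ball_zero_iff, norm_smul, ht, mul_one, Real.norm_eq_abs] at hR
    exact ⟨s, abs_lt.1 hR, by simp [linePath]⟩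
  · rintro ⟨s, hs, rfl⟩
    refine ⟨by simpa [linePath] using
      Submodule.smul_mem _ s (Submodule.mem_span_singleton_self t), ?_⟩
    rw [mem_ball_zero_iff]
    simpa [linePath, norm_smul, ht] using abs_lt.2 hs

variable [MeasurableSpace E] [BorelSpace E]

theorem measurableEmbedding_linePath (p : E) {v : E} (hv : ‖v‖ = 1) :
    MeasurableEmbedding (linePath p v) :=
  (isometry_linePath p hv).isClosedEmbedding.measurableEmbedding

theorem measurableSet_linePath_image (p : E) {v : E} (hv : ‖v‖ = 1) {S : Set ℝ}
    (hS : MeasurableSet S) : MeasurableSet (linePath p v '' S) :=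
  (measurableEmbedding_linePath p hv).measurableSet_image.2 hS

theorem hausdorffMeasure_restrict_linePath_image (p : E) {v : E} (hv : ‖v‖ = 1) {S : Set ℝ}
    (hS : MeasurableSet S) :
    (μH[1] : Measure E).restrict (linePath p v '' S) =
      (volume.restrict S).map (linePath p v) := by
  have hi := isometry_linePath p hv
  have h1 : (μH[1] : Measure E).restrict (Set.range (linePath p v)) =
      volume.map (linePath p v) := by
    rw [← hausdorffMeasure_real, hi.map_hausdorffMeasure (Or.inl zero_le_one)]
  have h2 : (μH[1] : Measure E).restrict (linePath p v '' S) =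
      ((μH[1] : Measure E).restrict (Set.range (linePath p v))).restrict (linePath p v '' S) := by
    rw [Measure.restrict_restrict (measurableSet_linePath_image p hv hS),
      Set.inter_eq_left.2 (Set.image_subset_range _ _)]
  rw [h2, h1, (measurableEmbedding_linePath p hv).restrict_map, hi.injective.preimage_image]

theorem hausdorffMeasure_linePath_image (p : E) {v : E} (hv : ‖v‖ = 1) (S : Set ℝ) :
    (μH[1] : Measure E) (linePath p v '' S) = volume S := by
  rw [(isometry_linePath p hv).hausdorffMeasure_image (Or.inl zero_le_one), hausdorffMeasure_real]

/-- The fundamental theorem of calculus along a segment. -/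
theorem integral_fderiv_linePath_image (p : E) {v : E} (hv : ‖v‖ = 1) {a b : ℝ} (hab : a ≤ b)
    {ζ : E → ℝ} (hζ : ContDiff ℝ 1 ζ) :
    ∫ x in linePath p v '' Set.Ioo a b, fderiv ℝ ζ x v ∂(μH[1] : Measure E) =
      ζ (linePath p v b) - ζ (linePath p v a) := by
  rw [hausdorffMeasure_restrict_linePath_image p hv measurableSet_Ioo,
    (measurableEmbedding_linePath p hv).integral_map, ← integral_Ioc_eq_integral_Ioo,
    ← intervalIntegral.integral_of_le hab]
  have hd : ∀ s : ℝ, HasDerivAt (fun s => ζ (linePath p v s))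
      (fderiv ℝ ζ (linePath p v s) v) s := fun s => by
    have h1 : HasDerivAt (linePath p v) v s := by
      have h2 := ((hasDerivAt_id s).smul_const v).const_add p
      rwa [one_smul] at h2
    exact ((hζ.differentiable (by norm_num)) _).hasFDerivAt.comp_hasDerivAt s h1
  have hc : Continuous fun s => fderiv ℝ ζ (linePath p v s) v :=
    ((hζ.continuous_fderiv (by norm_num)).comp (continuous_linePath p v)).clm_apply
      continuous_const
  exact intervalIntegral.integral_eq_sub_of_hasDerivAt (fun s _ => hd s)
    (hc.intervalIntegrable _ _)

end LinePath

/-! ### Supports of vector measures with a density -/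

section VectorSupport

theorem isClosed_vectorSupport {X V : Type*} [TopologicalSpace X] [MeasurableSpace X]
    [AddCommMonoid V] [TopologicalSpace V] (μ : VectorMeasure X V) :
    IsClosed (vectorSupport μ) := by
  rw [← isOpen_compl_iff, isOpen_iff_mem_nhds]
  intro x hx
  simp only [vectorSupport, Set.mem_compl_iff, Set.mem_ofPred_eq, not_forall, not_exists] at hx
  obtain ⟨U, hU, h⟩ := hx
  filter_upwards [eventually_mem_nhds_iff.2 hU] with y hy hy'
  obtain ⟨A, hA⟩ := hy' U hy
  exact h A hA

/-- Off the support the density has zero integral over all measurable subsets of some neighbourhood,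
so it vanishes a.e. there; second countability passes from local to global null sets. -/
theorem ae_eq_zero_of_notMem_vectorSupport {X V : Type*} [TopologicalSpace X]
    [SecondCountableTopology X] [MeasurableSpace X] [OpensMeasurableSpace X]
    [NormedAddCommGroup V] [NormedSpace ℝ V] [CompleteSpace V] {μ : Measure X} {f : X → V}
    (hf : Integrable f μ) : ∀ᵐ x ∂μ, x ∉ vectorSupport (μ.withDensityᵥ f) → f x = 0 := by
  rw [ae_iff]
  refine measure_null_of_locally_null _ fun x hx => ?_
  simp only [Set.mem_ofPred_eq, not_forall] at hx
  obtain ⟨hx, -⟩ := hx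
  simp only [vectorSupport, Set.mem_ofPred_eq, not_forall, not_exists] at hx
  obtain ⟨U, hU, h⟩ := hx
  have h0 : f =ᵐ[μ.restrict (interior U)] 0 := by
    refine (hf.restrict).ae_eq_zero_of_forall_setIntegral_eq_zero fun A hA _ => ?_
    rw [Measure.restrict_restrict hA,
      ← withDensityᵥ_apply hf (hA.inter isOpen_interior.measurableSet)]
    by_contra hne
    exact h _ ⟨Set.inter_subset_right.trans interior_subset,
      hA.inter isOpen_interior.measurableSet, hne⟩
  refine ⟨interior U ∩ {x | f x ≠ 0}, ?_, ?_⟩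
  · rw [mem_nhdsWithin]
    refine ⟨interior U, isOpen_interior, mem_interior_iff_mem_nhds.2 hU, fun y hy => ⟨hy.1, ?_⟩⟩
    have := hy.2
    simp only [Set.mem_ofPred_eq, not_forall] at this
    exact this.2
  · rw [EventuallyEq, ae_restrict_iff' isOpen_interior.measurableSet, ae_iff] at h0
    convert h0 using 2
    ext y
    simp

theorem integrable_indicator_of_nullMeasurableSet {X V : Type*} [MeasurableSpace X]
    [NormedAddCommGroup V] {μ : Measure X} {γ : Set X}
    (hγ : NullMeasurableSet γ μ) {f : X → V} (hf : IntegrableOn f γ μ) :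
    Integrable (γ.indicator f) μ := by
  have hae := hγ.toMeasurable_ae_eq
  refine (Integrable.congr ?_ (indicator_ae_eq_of_ae_eq_set hae))
  rw [integrable_indicator_iff (measurableSet_toMeasurable _ _), IntegrableOn,
    Measure.restrict_congr_set hae]
  exact hf

/-- Measures carried by different sets become densities of one common measure and can be subtracted
pointwise. A rectifiable carrier is only null measurable. -/
theorem withDensityᵥ_restrict_eq_indicator {X V : Type*} [MeasurableSpace X]
    [NormedAddCommGroup V] [NormedSpace ℝ V] {μ : Measure X} {γ : Set X}
    (hγ : NullMeasurableSet γ μ) {f : X → V} (hf : IntegrableOn f γ μ) :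
    (μ.restrict γ).withDensityᵥ f = μ.withDensityᵥ (γ.indicator f) := by
  ext A hA
  have hi : Integrable (γ.indicator f) μ := integrable_indicator_of_nullMeasurableSet hγ hf
  rw [withDensityᵥ_apply hf hA, withDensityᵥ_apply hi hA,
    integral_indicator₀ (hγ.mono_ac Measure.absolutelyContinuous_restrict),
    Measure.restrict_restrict hA,
    Measure.restrict_restrict₀ (hγ.mono_ac Measure.absolutelyContinuous_restrict), Set.inter_comm]

end VectorSupport

/-! ### Total mass of an admissible current -/

section LowerBound

theorem RectCurrent.integrable_tensor {m n : ℕ} {Ω : Set (EuclideanSpace ℝ (Fin n))}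
    (T : RectCurrent m n Ω) :
    Integrable (fun x i => (T.mult x i : ℝ) • T.tangent x : _ → Fin m → EuclideanSpace ℝ (Fin n))
      ((μH[1]).restrict T.carrier) := by
  refine Integrable.of_eval fun i => ?_
  have h1 : Integrable (fun x => (T.mult x i : ℝ)) ((μH[1]).restrict T.carrier) :=
    (EuclideanSpace.proj (𝕜 := ℝ) i).integrable_comp T.integrable_mult
  refine h1.norm.mono' (h1.aestronglyMeasurable.smul
    T.aemeasurable_tangent.aestronglyMeasurable) ?_
  filter_upwards [T.tangent_spec] with x hx
  rw [norm_smul, hx.1, mul_one]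

/-- A smooth compactly supported function in the ball whose gradient is `a` on a smaller ball. -/
theorem exists_contDiff_fderiv_eq_inner {E : Type*} [NormedAddCommGroup E] [InnerProductSpace ℝ E]
    [FiniteDimensional ℝ E] {r R : ℝ} (hr : 0 < r) (hR : r < R) (a : E) :
    ∃ ζ : E → ℝ, ContDiff ℝ ∞ ζ ∧ HasCompactSupport ζ ∧ tsupport ζ ⊆ Metric.ball 0 R ∧
      ∀ x ∈ Metric.ball (0 : E) r, fderiv ℝ ζ x = innerSL ℝ a := by
  obtain ⟨R', hrR', hR'⟩ := exists_between hR
  let χ : ContDiffBump (0 : E) := ⟨r, R', hr, hrR'⟩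
  refine ⟨fun x => χ x * inner ℝ a x, χ.contDiff.mul (innerSL ℝ a).contDiff,
    χ.hasCompactSupport.mul_right, ?_, fun x hx => ?_⟩
  · refine (tsupport_mul_subset_left (f := χ) (g := fun x => inner ℝ a x)).trans ?_
    rw [χ.tsupport_eq]
    exact Metric.closedBall_subset_ball hR'
  · have h : (fun x => χ x * inner ℝ a x) =ᶠ[𝓝 x] innerSL ℝ a := by
      filter_upwards [Metric.isOpen_ball.mem_nhds hx] with y hy
      simp [χ.one_of_mem_closedBall (Metric.ball_subset_closedBall hy)]
    rw [h.fderiv_eq, ContinuousLinearMap.fderiv]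

/-- Test with a cutoff `ζ` of the linear function `a · x`. The pairing with `∇ζ` vanishes for the
current and for the line, and `∇ζ = a` where the two differ. -/
theorem RectCurrent.integral_mult_inner_tangent {m n : ℕ} {R : ℝ}
    (hR : 0 < R) (T : RectCurrent m n (Metric.ball 0 R)) (hdiv : T.DivFree) (b : Fin m → ℤ)
    {t : EuclideanSpace ℝ (Fin n)} (ht : ‖t‖ = 1)
    (hsupp : vectorSupport (T.toMeasure - tensorMeasure
      ((Submodule.span ℝ {t} : Set (EuclideanSpace ℝ (Fin n))) ∩ Metric.ball 0 R)
      (fun _ => b) (fun _ => t)) ⊆ Metric.ball 0 R)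
    (i : Fin m) (a : EuclideanSpace ℝ (Fin n)) :
    ∫ x in T.carrier, (T.mult x i : ℝ) * inner ℝ a (T.tangent x) ∂μH[1] =
      2 * R * (b i * inner ℝ a t) := by
  have hL : (Submodule.span ℝ {t} : Set (EuclideanSpace ℝ (Fin n))) ∩ Metric.ball 0 R =
    linePath 0 t '' Set.Ioo (-R) R := span_inter_ball_eq_linePath_image ht R
  set L := (Submodule.span ℝ {t} : Set (EuclideanSpace ℝ (Fin n))) ∩ Metric.ball 0 R
  set f : EuclideanSpace ℝ (Fin n) → Fin m → EuclideanSpace ℝ (Fin n) :=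
    fun x i => (T.mult x i : ℝ) • T.tangent x with hf
  set g : EuclideanSpace ℝ (Fin n) → Fin m → EuclideanSpace ℝ (Fin n) :=
    fun x i => (b i : ℝ) • t with hg
  have hLm : MeasurableSet L := hL ▸ measurableSet_linePath_image 0 ht measurableSet_Ioo
  have hLv : μH[1] L = ENNReal.ofReal (2 * R) := by
    rw [hL, hausdorffMeasure_linePath_image 0 ht, Real.volume_Ioo]
    ring_nf
  have hfi : IntegrableOn f T.carrier μH[1] := T.integrable_tensor
  have hgi : IntegrableOn g L μH[1] := integrableOn_const (hLv ▸ ENNReal.ofReal_ne_top)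
  have hγ := T.rectifiable.1
  have hfi' := integrable_indicator_of_nullMeasurableSet hγ hfi
  have hgi' := integrable_indicator_of_nullMeasurableSet hLm.nullMeasurableSet hgi
  have hdiff : T.toMeasure - tensorMeasure L (fun _ => b) (fun _ => t) =
      (μH[1]).withDensityᵥ (T.carrier.indicator f - L.indicator g) := by
    rw [withDensityᵥ_sub hfi' hgi', ← withDensityᵥ_restrict_eq_indicator hγ hfi,
      ← withDensityᵥ_restrict_eq_indicator hLm.nullMeasurableSet hgi]
    rfl
  have hzero := ae_eq_zero_of_notMem_vectorSupport (hfi'.sub hgi')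
  rw [← hdiff] at hzero
  obtain ⟨r, hrR, hr⟩ := exists_lt_subset_ball (isClosed_vectorSupport _) hsupp
  -- The support may be empty and `r ≤ 0`; the maximum with `R / 2` keeps the radius positive.
  obtain ⟨ζ, hζ, hζc, hζs, hζd⟩ := exists_contDiff_fderiv_eq_inner
    (r := max r (R / 2)) (by positivity) (max_lt hrR (by linarith)) a
  have hζ1 : ContDiff ℝ 1 ζ := hζ.of_le (by exact_mod_cast le_top)
  have hcont : Continuous (fderiv ℝ ζ) := hζ1.continuous_fderiv (by norm_num)
  obtain ⟨C, hC⟩ := hcont.bounded_above_of_compact_support (hζc.fderiv ℝ)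
  let G := fun x => fderiv ℝ ζ x - innerSL ℝ a
  -- On the support of the difference `G = 0`, and off it the two densities agree a.e.
  have key : ∫ x in T.carrier, G x (f x i) ∂μH[1] = ∫ x in L, G x (g x i) ∂μH[1] := by
    rw [← integral_indicator₀ hγ, ← integral_indicator hLm]
    refine integral_congr_ae ?_
    filter_upwards [hzero] with x hx
    have h1 : ∀ (S : Set (EuclideanSpace ℝ (Fin n)))
        (k : EuclideanSpace ℝ (Fin n) → Fin m → EuclideanSpace ℝ (Fin n)),
        S.indicator (fun x => G x (k x i)) x = G x (S.indicator k x i) := fun S k => by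
      by_cases hxS : x ∈ S <;> simp [hxS]
    rw [h1, h1]
    by_cases hK : x ∈ vectorSupport (T.toMeasure - tensorMeasure L (fun _ => b) (fun _ => t))
    · have : G x = 0 := sub_eq_zero.2
        (hζd x (Metric.ball_subset_ball (le_max_left _ _) (hr hK)))
      simp [this]
    · rw [sub_eq_zero.1 (hx hK)]
  have hint : ∀ {S : Set (EuclideanSpace ℝ (Fin n))}
      {k : EuclideanSpace ℝ (Fin n) → Fin m → EuclideanSpace ℝ (Fin n)},
      IntegrableOn k S μH[1] → ∫ x in S, G x (k x i) ∂μH[1] =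
        ∫ x in S, fderiv ℝ ζ x (k x i) ∂μH[1] - ∫ x in S, inner ℝ a (k x i) ∂μH[1] := by
    intro S k hk
    have hk' : IntegrableOn (fun x => k x i) S μH[1] := hk.eval i
    refine integral_sub ?_ ((innerSL ℝ a).integrable_comp hk')
    refine (hk'.norm.const_mul C).mono'
      (isBoundedBilinearMap_apply.continuous.comp_aestronglyMeasurable
        (hcont.aestronglyMeasurable.prodMk hk'.aestronglyMeasurable)) (ae_of_all _ fun x => ?_)
    exact ((fderiv ℝ ζ x).le_opNorm _).trans
      (mul_le_mul_of_nonneg_right (hC x) (norm_nonneg _))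
  have h1 : ∫ x in T.carrier, fderiv ℝ ζ x (f x i) ∂μH[1] = 0 := by
    simpa [hf] using hdiv ζ hζ hζc hζs i
  have h2 : ∫ x in L, fderiv ℝ ζ x (g x i) ∂μH[1] = 0 := by
    have hend : ∀ s : ℝ, |s| = R → ζ (linePath 0 t s) = 0 := fun s hs => by
      refine image_eq_zero_of_notMem_tsupport fun hmem => ?_
      have := mem_ball_zero_iff.1 (hζs hmem)
      simp [linePath, norm_smul, ht, hs] at this
    simp only [hg, map_smul, smul_eq_mul]
    rw [integral_const_mul, hL, integral_fderiv_linePath_image 0 ht (by linarith) hζ1,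
      hend R (abs_of_pos hR), hend (-R) (by rw [abs_neg, abs_of_pos hR])]
    simp
  rw [hint hfi, hint hgi, h1, h2] at key
  have h3 : ∫ x in T.carrier, inner ℝ a (f x i) ∂μH[1] =
      ∫ x in L, inner ℝ a (g x i) ∂μH[1] := by linarith
  simp only [hf, hg, inner_smul_right] at h3
  rw [h3, setIntegral_const, Measure.real, hLv, ENNReal.toReal_ofReal (by linarith), smul_eq_mul]

/-! ### The calibration and the lower bound -/

theorem cubicDensity_nonneg {n : ℕ} {η : ℝ} (hη : 0 ≤ η) (b : Fin n → ℤ)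
    (t : EuclideanSpace ℝ (Fin n)) : 0 ≤ cubicDensity η b t := by
  unfold cubicDensity; positivity

/-- The gradient at `t` of the `1`-homogeneous extension of `t ↦ 1 + η tᵢ²`. -/
noncomputable def cubicCalibration {n : ℕ} (η : ℝ) (i : Fin n) (t : EuclideanSpace ℝ (Fin n)) :
    EuclideanSpace ℝ (Fin n) :=
  (1 - η * t i ^ 2) • t + (2 * η * t i) • EuclideanSpace.single i (1 : ℝ)

theorem inner_cubicCalibration {n : ℕ} (η : ℝ) (i : Fin n) (t x : EuclideanSpace ℝ (Fin n)) :
    inner ℝ (cubicCalibration η i t) x = (1 - η * t i ^ 2) * inner ℝ t x + 2 * η * t i * x i := by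
  simp [cubicCalibration, inner_add_left, inner_smul_left, EuclideanSpace.inner_single_left]

theorem sq_apply_le_one {n : ℕ} {t : EuclideanSpace ℝ (Fin n)} (ht : ‖t‖ = 1) (i : Fin n) :
    t i ^ 2 ≤ 1 := by
  have h := PiLp.norm_apply_le t i
  rw [ht, Real.norm_eq_abs] at h
  exact (sq_le_one_iff_abs_le_one _).2 h

theorem abs_inner_cubicCalibration_le_two {n : ℕ} {η : ℝ} (hη0 : 0 ≤ η) (hη1 : η ≤ 1) (i : Fin n)
    {t x : EuclideanSpace ℝ (Fin n)} (ht : ‖t‖ = 1) (hx : ‖x‖ = 1) :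
    |inner ℝ (cubicCalibration η i t) x| ≤ 2 := by
  have hs := sq_apply_le_one ht i
  have hs0 := sq_nonneg (t i)
  have hn : ‖cubicCalibration η i t‖ ^ 2 ≤ 2 ^ 2 := by
    rw [← real_inner_self_eq_norm_sq, inner_cubicCalibration, real_inner_comm,
      inner_cubicCalibration, real_inner_self_eq_norm_sq, ht]
    have : (cubicCalibration η i t) i = (1 - η * t i ^ 2) * t i + 2 * η * t i := by
      simp [cubicCalibration]
    rw [this]
    have hu : η * t i ^ 2 ≤ 1 := mul_le_one₀ hη1 hs0 hs
    have hu0 : 0 ≤ η * t i ^ 2 := by positivity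
    have h3 : η * (η * t i ^ 2) ≤ η * t i ^ 2 := mul_le_of_le_one_left hu0 hη1
    -- With `u = η t_i²` and `η u ≤ u`, the squared norm is at most `4 - 3 (1 - u)²`.
    nlinarith [sq_nonneg (1 - η * t i ^ 2)]
  have h2 := abs_real_inner_le_norm (cubicCalibration η i t) x
  rw [hx, mul_one] at h2
  exact h2.trans ((sq_le_sq₀ (norm_nonneg _) (by norm_num)).1 hn)

/-- With `a` the calibration and `c = t · x`, one has `1 + η x_i² - a · x = (1 - η t_i²)(1 - c) + η
(t_i - x_i)²`, a sum of nonnegative terms. Changing the sign of `x` gives the other half. -/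
theorem abs_inner_cubicCalibration_le {n : ℕ} {η : ℝ} (hη0 : 0 ≤ η) (hη1 : η ≤ 1) (i : Fin n)
    {t x : EuclideanSpace ℝ (Fin n)} (ht : ‖t‖ = 1) (hx : ‖x‖ = 1) :
    |inner ℝ (cubicCalibration η i t) x| ≤ 1 + η * x i ^ 2 := by
  have hu : η * t i ^ 2 ≤ 1 := mul_le_one₀ hη1 (sq_nonneg _) (sq_apply_le_one ht i)
  have hc := abs_le.1 (abs_real_inner_le_norm t x)
  rw [ht, hx, mul_one] at hc
  rw [inner_cubicCalibration]
  have h1 := mul_nonneg hη0 (sq_nonneg (t i - x i))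
  have h2 := mul_nonneg hη0 (sq_nonneg (t i + x i))
  rw [abs_le]
  constructor <;> nlinarith

theorem norm_intVec_sq {m : ℕ} (b : Fin m → ℤ) : ‖intVec b‖ ^ 2 = ∑ j, (b j : ℝ) ^ 2 := by
  simp [EuclideanSpace.norm_sq_eq, intVec]

theorem cubicDensity_single {n : ℕ} (η : ℝ) (i : Fin n) (c : ℤ) (t : EuclideanSpace ℝ (Fin n)) :
    cubicDensity η (c • (Pi.single i 1 : Fin n → ℤ)) t = (c : ℝ) ^ 2 * (1 + η * t i ^ 2) := by
  have hb : intVec (c • (Pi.single i 1 : Fin n → ℤ)) =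
      (c : ℝ) • EuclideanSpace.single i (1 : ℝ) := by
    ext j
    by_cases hj : j = i
    · subst hj; simp [intVec]
    · simp [intVec, hj]
  rw [cubicDensity, hb, norm_smul, inner_smul_left, EuclideanSpace.inner_single_left]
  simp [mul_pow]
  ring

theorem mul_inner_cubicCalibration_le_cubicDensity {n : ℕ} {η : ℝ} (hη0 : 0 ≤ η) (hη1 : η ≤ 1)
    (i : Fin n) {t x : EuclideanSpace ℝ (Fin n)} (ht : ‖t‖ = 1) (hx : ‖x‖ = 1) (b : Fin n → ℤ) :
    |(b i : ℝ) * inner ℝ (cubicCalibration η i t) x| ≤ cubicDensity η b x := by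
  rw [abs_mul]
  by_cases hb : ∀ j, j ≠ i → b j = 0
  · have hb' : b = b i • (Pi.single i 1 : Fin n → ℤ) := by
      ext j
      by_cases hj : j = i
      · subst hj; simp
      · simp [hb j hj, hj]
    have h1 : |(b i : ℝ)| ≤ (b i : ℝ) ^ 2 := by
      rw [← sq_abs]
      rcases eq_or_ne (b i) 0 with h | h
      · simp [h]
      · have : (1 : ℝ) ≤ |(b i : ℝ)| := by exact_mod_cast Int.one_le_abs h
        nlinarith
    rw [hb', cubicDensity_single, ← hb']
    exact mul_le_mul h1 (abs_inner_cubicCalibration_le hη0 hη1 i ht hx) (abs_nonneg _)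
      (sq_nonneg _)
  · push Not at hb
    obtain ⟨j, hji, hj⟩ := hb
    have h1 : (b i : ℝ) ^ 2 + (b j : ℝ) ^ 2 ≤ ‖intVec b‖ ^ 2 := by
      rw [norm_intVec_sq, ← Finset.sum_pair (f := fun j => (b j : ℝ) ^ 2) hji.symm]
      exact Finset.sum_le_univ_sum_of_nonneg fun _ => sq_nonneg _
    have h2 : (1 : ℝ) ≤ (b j : ℝ) ^ 2 := by
      exact_mod_cast (Int.one_le_abs hj).trans (by
        rw [← sq_abs]; nlinarith [Int.one_le_abs hj])
    have h3 := abs_inner_cubicCalibration_le_two hη0 hη1 i ht hx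
    have h4 : 0 ≤ η * (inner ℝ (intVec b) x) ^ 2 := by positivity
    rw [cubicDensity]
    -- `2 |b_i| ≤ b_i² + 1 ≤ b_i² + b_j²`.
    nlinarith [sq_nonneg (|(b i : ℝ)| - 1), sq_abs (b i : ℝ), abs_nonneg (b i : ℝ),
      mul_le_mul_of_nonneg_left h3 (abs_nonneg (b i : ℝ))]

theorem le_hOneEnvelope_cubicDensity {n : ℕ} {η : ℝ} (hη0 : 0 ≤ η) (hη1 : η ≤ 1) (i : Fin n)
    (b : Fin n → ℤ) {t : EuclideanSpace ℝ (Fin n)} (ht : ‖t‖ = 1) :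
    ENNReal.ofReal (|(b i : ℝ)| * (1 + η * t i ^ 2)) ≤ hOneEnvelope (cubicDensity η) b t := by
  refine le_iInf fun T => le_iInf fun hdiv => le_iInf fun hsupp => ?_
  have h := T.integral_mult_inner_tangent (by norm_num) hdiv b ht hsupp i (cubicCalibration η i t)
  have hval : inner ℝ (cubicCalibration η i t) t = 1 + η * t i ^ 2 := by
    rw [inner_cubicCalibration, real_inner_self_eq_norm_sq, ht]; ring
  have hpos : 0 ≤ 1 + η * t i ^ 2 := by positivity
  calc ENNReal.ofReal (|(b i : ℝ)| * (1 + η * t i ^ 2))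
      = ENNReal.ofReal ‖∫ x in T.carrier,
          (T.mult x i : ℝ) * inner ℝ (cubicCalibration η i t) (T.tangent x) ∂μH[1]‖ := by
        rw [h, hval, Real.norm_eq_abs]
        -- The factor `2 R` is 1 for the radius `1 / 2`.
        congr 1
        rw [← abs_of_nonneg hpos, ← abs_mul, abs_of_nonneg hpos]
        norm_num
    _ ≤ ∫⁻ x in T.carrier, ‖(T.mult x i : ℝ) *
          inner ℝ (cubicCalibration η i t) (T.tangent x)‖ₑ ∂μH[1] := by
        rw [ofReal_norm]
        exact enorm_integral_le_lintegral_enorm _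
    _ ≤ T.energy (cubicDensity η) := by
        refine lintegral_mono_ae ?_
        filter_upwards [T.tangent_spec] with x hx
        rw [← ofReal_norm, Real.norm_eq_abs]
        exact ENNReal.ofReal_le_ofReal
          (mul_inner_cubicCalibration_le_cubicDensity hη0 hη1 i ht hx.1 _)

end LowerBound

/-! ### Polyhedral currents -/

/-- A finite family of open segments with multiplicities, each disjoint from the closures of the
others. -/
structure SegmentFamily (ι : Type*) (m n : ℕ) where
  base : ι → EuclideanSpace ℝ (Fin n)
  dir : ι → EuclideanSpace ℝ (Fin n)
  lo : ι → ℝ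
  hi : ι → ℝ
  mult : ι → Fin m → ℤ
  norm_dir : ∀ j, ‖dir j‖ = 1
  lo_le_hi : ∀ j, lo j ≤ hi j
  disjoint_closure : ∀ j k, j ≠ k → Disjoint (linePath (base j) (dir j) '' Set.Ioo (lo j) (hi j))
    (linePath (base k) (dir k) '' Set.Icc (lo k) (hi k))

namespace SegmentFamily

variable {ι : Type*} {m n : ℕ} (F : SegmentFamily ι m n)

/-- The `j`-th open segment. -/
def seg (j : ι) : Set (EuclideanSpace ℝ (Fin n)) :=
  linePath (F.base j) (F.dir j) '' Set.Ioo (F.lo j) (F.hi j)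

theorem pairwise_disjoint_seg : Pairwise (Function.onFun Disjoint F.seg) := fun j k hjk =>
  (F.disjoint_closure j k hjk).mono_right (Set.image_mono Set.Ioo_subset_Icc_self)

theorem measurableSet_seg (j : ι) : MeasurableSet (F.seg j) :=
  measurableSet_linePath_image _ (F.norm_dir j) measurableSet_Ioo

theorem hausdorffMeasure_seg (j : ι) : μH[1] (F.seg j) = ENNReal.ofReal (F.hi j - F.lo j) := by
  rw [seg, hausdorffMeasure_linePath_image _ (F.norm_dir j), Real.volume_Ioo]

open Classical in
/-- The function with the value `c j` on the `j`-th segment. -/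
noncomputable def piecewise {α : Type*} [Zero α] (c : ι → α) (x : EuclideanSpace ℝ (Fin n)) : α :=
  if h : ∃ j, x ∈ F.seg j then c h.choose else 0

theorem piecewise_of_mem {α : Type*} [Zero α] (c : ι → α) {j : ι} {x : EuclideanSpace ℝ (Fin n)}
    (hx : x ∈ F.seg j) : F.piecewise c x = c j := by
  have h : ∃ j, x ∈ F.seg j := ⟨j, hx⟩
  rw [piecewise, dif_pos h]
  by_contra hne
  have hjk : h.choose ≠ j := fun e => hne (by rw [e])
  exact Set.disjoint_left.1 (F.pairwise_disjoint_seg hjk) h.choose_spec hx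

variable [Finite ι]

/-- Segments may share end points, but an interior point of one has positive distance from the
closures of the finitely many others, so a small ball sees only a diameter. -/
theorem eventually_inter_closedBall_eq {j : ι} {s : ℝ} (hs : s ∈ Set.Ioo (F.lo j) (F.hi j)) :
    ∀ᶠ r in 𝓝[>] (0 : ℝ), (⋃ k, F.seg k) ∩
        Metric.closedBall (linePath (F.base j) (F.dir j) s) r =
      linePath (F.base j) (F.dir j) '' Set.Icc (s - r) (s + r) := by
  set x := linePath (F.base j) (F.dir j) s
  have hiso := isometry_linePath (F.base j) (F.norm_dir j)
  have hclosed : IsClosed (⋃ k ∈ {k | k ≠ j},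
      linePath (F.base k) (F.dir k) '' Set.Icc (F.lo k) (F.hi k)) :=
    (Set.toFinite _).isClosed_biUnion fun k _ =>
      (isCompact_Icc.image (continuous_linePath _ _)).isClosed
  have hx : x ∈ (⋃ k ∈ {k | k ≠ j},
      linePath (F.base k) (F.dir k) '' Set.Icc (F.lo k) (F.hi k))ᶜ := by
    simp only [Set.mem_compl_iff, Set.mem_iUnion, not_exists]
    intro k hk hxk
    exact Set.disjoint_left.1 (F.disjoint_closure j k (Ne.symm hk)) ⟨s, hs, rfl⟩ hxk
  obtain ⟨ρ, hρ, hρx⟩ := Metric.nhds_basis_closedBall.mem_iff.1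
    (hclosed.isOpen_compl.mem_nhds hx)
  have hmin : 0 < min ρ (min (s - F.lo j) (F.hi j - s)) :=
    lt_min hρ (lt_min (sub_pos.2 hs.1) (sub_pos.2 hs.2))
  filter_upwards [Ioo_mem_nhdsGT hmin] with r hr
  obtain ⟨hr1, hr2, hr3⟩ : r < ρ ∧ r < s - F.lo j ∧ r < F.hi j - s := by
    simpa [lt_min_iff] using hr.2
  have hdist : ∀ u, dist (linePath (F.base j) (F.dir j) u) x ≤ r ↔ u ∈ Set.Icc (s - r) (s + r) := by
    intro u
    rw [hiso.dist_eq, Real.dist_eq, abs_le, Set.mem_Icc]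
    constructor <;> rintro ⟨h1, h2⟩ <;> constructor <;> linarith
  ext y
  constructor
  · rintro ⟨hy, hyr⟩
    obtain ⟨k, hk⟩ := Set.mem_iUnion.1 hy
    by_cases hkj : k = j
    · subst hkj
      obtain ⟨u, hu, rfl⟩ := hk
      exact ⟨u, (hdist u).1 hyr, rfl⟩
    · exact absurd (Set.mem_biUnion (show k ∈ {k | k ≠ j} from hkj)
        (Set.image_mono Set.Ioo_subset_Icc_self hk))
        (hρx (Metric.closedBall_subset_closedBall hr1.le hyr))
  · rintro ⟨u, hu, rfl⟩
    exact ⟨Set.mem_iUnion.2 ⟨j, u, ⟨by linarith [hu.1], by linarith [hu.2]⟩, rfl⟩, (hdist u).2 hu⟩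

theorem isApproxTangent {j : ι} {x : EuclideanSpace ℝ (Fin n)} (hx : x ∈ F.seg j) :
    IsApproxTangent (⋃ k, F.seg k) x (F.dir j) := by
  obtain ⟨s, hs, rfl⟩ := hx
  have hev := F.eventually_inter_closedBall_eq hs
  constructor
  · have h2 : (fun r : ℝ => μH[1] ((⋃ k, F.seg k) ∩
        Metric.closedBall (linePath (F.base j) (F.dir j) s) r) / ENNReal.ofReal r)
        =ᶠ[𝓝[>] 0] fun _ => 2 := by
      filter_upwards [hev, self_mem_nhdsWithin] with r hr hr0
      rw [hr, hausdorffMeasure_linePath_image _ (F.norm_dir j), Real.volume_Icc,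
        show s + r - (s - r) = 2 * r by ring, ENNReal.ofReal_mul (by norm_num),
        mul_div_assoc, ENNReal.div_self (ENNReal.ofReal_pos.2 hr0).ne'
          ENNReal.ofReal_ne_top]
      simp
    rw [limsup_congr h2, limsup_const]
    norm_num
  · intro c hc
    refine Tendsto.congr' ?_ tendsto_const_nhds
    filter_upwards [hev] with r hr
    rw [hr]
    -- The diameter lies on the tangent line, so only the centre, a null set, can lie outside the
    -- open cone.
    have hatom : NullSingletonClass (μH[1] : Measure (EuclideanSpace ℝ (Fin n))) :=
      Measure.nullSingletonClass_hausdorff _ one_pos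
    refine (ENNReal.div_eq_zero_iff.2 (Or.inl (measure_mono_null ?_
      (measure_singleton (linePath (F.base j) (F.dir j) s))))).symm
    rintro y ⟨⟨u, hu, rfl⟩, hy⟩
    have hmem : linePath (F.base j) (F.dir j) u - linePath (F.base j) (F.dir j) s ∈
        (Submodule.span ℝ {F.dir j} : Set (EuclideanSpace ℝ (Fin n))) := by
      rw [linePath, linePath, add_sub_add_left_eq_sub, ← sub_smul]
      exact Submodule.smul_mem _ _ (Submodule.mem_span_singleton_self _)
    rw [Set.mem_ofPred_eq, Metric.infDist_zero_of_mem hmem] at hy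
    exact sub_eq_zero.1 (norm_le_zero_iff.1 (nonpos_of_mul_nonpos_right hy hc))

theorem isOneRectifiable [Nonempty ι] : IsOneRectifiable (⋃ k, F.seg k) := by
  refine ⟨(MeasurableSet.iUnion F.measurableSet_seg).nullMeasurableSet, ?_, ?_⟩
  · have := Fintype.ofFinite ι
    refine (measure_iUnion_fintype_le _ _).trans_lt (ENNReal.sum_lt_top.2 fun j _ => ?_)
    rw [F.hausdorffMeasure_seg]
    exact ENNReal.ofReal_lt_top
  · obtain ⟨e, he⟩ := exists_surjective_nat ι
    refine ⟨fun k => linePath (F.base (e k)) (F.dir (e k)),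
      fun k => ⟨1, (isometry_linePath _ (F.norm_dir _)).lipschitz⟩, ?_⟩
    rw [Set.sdiff_eq_empty.2, measure_empty]
    refine Set.iUnion_subset fun j => ?_
    obtain ⟨k, rfl⟩ := he j
    exact (Set.image_subset_range _ _).trans
      (Set.subset_iUnion (fun k => Set.range (linePath (F.base (e k)) (F.dir (e k)))) k)

/-- The polyhedral current of a finite family of segments. -/
noncomputable def toRectCurrent [Nonempty ι] {Ω : Set (EuclideanSpace ℝ (Fin n))}
    (hΩ : ∀ j, F.seg j ⊆ Ω) : RectCurrent m n Ω where
  carrier := ⋃ k, F.seg k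
  mult := F.piecewise F.mult
  tangent := F.piecewise F.dir
  carrier_subset := Set.iUnion_subset hΩ
  rectifiable := F.isOneRectifiable
  integrable_mult := by
    refine (integrableOn_finite_iUnion (μ := μH[1])).2 fun j => ?_
    refine (integrableOn_const (μ := μH[1]) (s := F.seg j) (C := intVec (F.mult j))
      (by rw [F.hausdorffMeasure_seg]; exact ENNReal.ofReal_ne_top)).congr_fun (fun x hx => ?_)
      (F.measurableSet_seg j)
    simp only [F.piecewise_of_mem F.mult hx]
  aemeasurable_tangent := by
    refine aemeasurable_iUnion_iff.2 fun j => ?_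
    refine (aemeasurable_const (b := F.dir j)).congr ?_
    filter_upwards [ae_restrict_mem (F.measurableSet_seg j)] with x hx
    rw [F.piecewise_of_mem F.dir hx]
  tangent_spec := by
    filter_upwards [ae_restrict_mem (MeasurableSet.iUnion F.measurableSet_seg)] with x hx
    obtain ⟨j, hj⟩ := Set.mem_iUnion.1 hx
    rw [F.piecewise_of_mem F.dir hj]
    exact ⟨F.norm_dir j, F.isApproxTangent hj⟩

variable [Nonempty ι] {Ω : Set (EuclideanSpace ℝ (Fin n))} (hΩ : ∀ j, F.seg j ⊆ Ω)

theorem energy_toRectCurrent {ι : Type*} [Fintype ι] [Nonempty ι] (F : SegmentFamily ι m n)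
    (hΩ : ∀ j, F.seg j ⊆ Ω) (ψ : (Fin m → ℤ) → EuclideanSpace ℝ (Fin n) → ℝ) :
    (F.toRectCurrent hΩ).energy ψ =
      ∑ j, ENNReal.ofReal (ψ (F.mult j) (F.dir j)) * ENNReal.ofReal (F.hi j - F.lo j) := by
  change ∫⁻ x in ⋃ k, F.seg k, ENNReal.ofReal (ψ (F.piecewise F.mult x) (F.piecewise F.dir x))
    ∂μH[1] = _
  rw [lintegral_iUnion F.measurableSet_seg F.pairwise_disjoint_seg, tsum_fintype]
  refine Finset.sum_congr rfl fun j _ => ?_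
  rw [← F.hausdorffMeasure_seg, ← setLIntegral_const]
  refine setLIntegral_congr_fun (F.measurableSet_seg j) fun x hx => ?_
  simp only [F.piecewise_of_mem _ hx]

/-- On each segment the integral is a difference of end point values, so closedness is a balance of
multiplicities at the nodes. -/
theorem divFree_toRectCurrent {ι : Type*} [Fintype ι] [Nonempty ι] (F : SegmentFamily ι m n)
    (hΩ : ∀ j, F.seg j ⊆ Ω)
    (h : ∀ ζ : EuclideanSpace ℝ (Fin n) → ℝ, tsupport ζ ⊆ Ω → ∀ i : Fin m,
      ∑ j, (F.mult j i : ℝ) * (ζ (linePath (F.base j) (F.dir j) (F.hi j)) -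
        ζ (linePath (F.base j) (F.dir j) (F.lo j))) = 0) :
    (F.toRectCurrent hΩ).DivFree := by
  intro ζ hζ hζc hζs i
  rw [← h ζ hζs i]
  have hζ1 : ContDiff ℝ 1 ζ := hζ.of_le (by exact_mod_cast le_top)
  have hC : Continuous (fderiv ℝ ζ) := hζ1.continuous_fderiv (by norm_num)
  obtain ⟨C, hC'⟩ := hC.bounded_above_of_compact_support (hζc.fderiv ℝ)
  have hon : ∀ j, ∀ x ∈ F.seg j, (F.mult j i : ℝ) * fderiv ℝ ζ x (F.dir j) =
      (F.piecewise F.mult x i : ℝ) * fderiv ℝ ζ x (F.piecewise F.dir x) := fun j x hx => by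
    rw [F.piecewise_of_mem _ hx, F.piecewise_of_mem _ hx]
  change ∫ x in ⋃ k, F.seg k, (F.piecewise F.mult x i : ℝ) *
    fderiv ℝ ζ x (F.piecewise F.dir x) ∂μH[1] = _
  rw [integral_iUnion_fintype F.measurableSet_seg F.pairwise_disjoint_seg]
  · refine Finset.sum_congr rfl fun j _ => ?_
    rw [← setIntegral_congr_fun (F.measurableSet_seg j) (hon j), integral_const_mul, seg,
      integral_fderiv_linePath_image _ (F.norm_dir j) (F.lo_le_hi j) hζ1]
  · intro j
    refine IntegrableOn.congr_fun ?_ (hon j) (F.measurableSet_seg j)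
    have hfin : μH[1] (F.seg j) < ⊤ := by
      rw [F.hausdorffMeasure_seg]; exact ENNReal.ofReal_lt_top
    refine Measure.integrableOn_of_bounded (M := |(F.mult j i : ℝ)| * C) hfin.ne
      (by fun_prop) (ae_of_all _ fun x => ?_)
    rw [norm_mul, Real.norm_eq_abs]
    refine mul_le_mul_of_nonneg_left ?_ (abs_nonneg _)
    have := (fderiv ℝ ζ x).le_opNorm (F.dir j)
    rw [F.norm_dir, mul_one] at this
    exact this.trans (hC' x)

/-- If the segments outside a closed set `K` make up the line `ℝ t ∩ Ω` with multiplicity `b`, the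
support of the difference lies in `K`. -/
theorem vectorSupport_toMeasure_sub_subset {K L : Set (EuclideanSpace ℝ (Fin n))}
    (hK : IsClosed K) (hL : MeasurableSet L) (hLf : μH[1] L ≠ ⊤)
    {b : Fin m → ℤ} {t : EuclideanSpace ℝ (Fin n)}
    (hLK : L \ K ⊆ ⋃ j, F.seg j)
    (hF : ∀ j, ∀ x ∈ F.seg j, x ∉ K → x ∈ L ∧ F.mult j = b ∧ F.dir j = t) :
    vectorSupport ((F.toRectCurrent hΩ).toMeasure - tensorMeasure L (fun _ => b) (fun _ => t)) ⊆
      K := by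
  intro x hx
  by_contra hxK
  obtain ⟨A, hAK, hA, hne⟩ := hx Kᶜ (hK.isOpen_compl.mem_nhds hxK)
  refine hne ?_
  have hγ : MeasurableSet (⋃ j, F.seg j) := MeasurableSet.iUnion F.measurableSet_seg
  have hfi := (F.toRectCurrent hΩ).integrable_tensor
  have hgi : Integrable (fun _ i => (b i : ℝ) • t : EuclideanSpace ℝ (Fin n) →
    Fin m → EuclideanSpace ℝ (Fin n)) ((μH[1]).restrict L) := integrableOn_const hLf
  rw [_root_.sub_apply, sub_eq_zero, RectCurrent.toMeasure, tensorMeasure, tensorMeasure,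
    withDensityᵥ_apply hfi hA, withDensityᵥ_apply hgi hA, Measure.restrict_restrict hA,
    Measure.restrict_restrict hA]
  have hset : A ∩ (F.toRectCurrent hΩ).carrier = A ∩ L := by
    ext y
    constructor
    · rintro ⟨hyA, hy⟩
      obtain ⟨j, hj⟩ := Set.mem_iUnion.1 hy
      exact ⟨hyA, (hF j y hj (hAK hyA)).1⟩
    · rintro ⟨hyA, hy⟩
      exact ⟨hyA, hLK ⟨hy, hAK hyA⟩⟩
  rw [hset]
  refine setIntegral_congr_fun (hA.inter hL) fun y hy => ?_
  obtain ⟨j, hj⟩ := Set.mem_iUnion.1 (hLK ⟨hy.2, hAK hy.1⟩)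
  obtain ⟨-, hb, ht⟩ := hF j y hj (hAK hy.1)
  change (fun i => (F.piecewise F.mult y i : ℝ) • F.piecewise F.dir y) = _
  rw [F.piecewise_of_mem _ hj, F.piecewise_of_mem _ hj, hb, ht]

end SegmentFamily

/-! ### Segments as graphs of affine functions in a plane -/

section GraphFamily

variable {ι : Type*} {m n : ℕ} {t u : EuclideanSpace ℝ (Fin n)}

theorem inner_graph_left (ht : ‖t‖ = 1) (hut : inner ℝ t u = 0) (x y : ℝ) :
    inner ℝ t (x • t + y • u) = x := by
  rw [inner_add_right, inner_smul_right, inner_smul_right, real_inner_self_eq_norm_sq, ht, hut]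
  ring

theorem inner_graph_right (hu : ‖u‖ = 1) (hut : inner ℝ t u = 0) (x y : ℝ) :
    inner ℝ u (x • t + y • u) = y := by
  rw [inner_add_right, inner_smul_right, inner_smul_right, real_inner_self_eq_norm_sq, hu,
    real_inner_comm, hut]
  ring

theorem norm_add_smul_pos (ht : ‖t‖ = 1) (hut : inner ℝ t u = 0) (q : ℝ) : 0 < ‖t + q • u‖ := by
  rw [norm_pos_iff]
  intro h
  have := inner_graph_left ht hut 1 q
  rw [one_smul, h, inner_zero_right] at this
  exact one_ne_zero this.symm

theorem linePath_graph (ht : ‖t‖ = 1) (hut : inner ℝ t u = 0) (p q x : ℝ) :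
    linePath (p • u) (‖t + q • u‖⁻¹ • (t + q • u)) (‖t + q • u‖ * x) =
      x • t + (p + q * x) • u := by
  rw [linePath, smul_smul, mul_right_comm, mul_inv_cancel₀ (norm_add_smul_pos ht hut q).ne',
    one_mul]
  module

/-- The family of the graphs of the affine functions `x ↦ p j + q j * x` over the intervals
`(a j, c j)` in the plane spanned by `t` and `u`. -/
noncomputable def graphFamily (ht : ‖t‖ = 1) (hu : ‖u‖ = 1) (hut : inner ℝ t u = 0)
    (p q a c : ι → ℝ) (θ : ι → Fin m → ℤ) (hac : ∀ j, a j ≤ c j)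
    (hdis : ∀ j k, j ≠ k → ∀ x ∈ Set.Ioo (a j) (c j), x ∈ Set.Icc (a k) (c k) →
      p j + q j * x ≠ p k + q k * x) : SegmentFamily ι m n where
  base j := p j • u
  dir j := ‖t + q j • u‖⁻¹ • (t + q j • u)
  lo j := ‖t + q j • u‖ * a j
  hi j := ‖t + q j • u‖ * c j
  mult := θ
  norm_dir j := by
    rw [norm_smul, norm_inv, norm_norm, inv_mul_cancel₀ (norm_add_smul_pos ht hut _).ne']
  lo_le_hi j := mul_le_mul_of_nonneg_left (hac j) (norm_nonneg _)
  disjoint_closure j k hjk := by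
    have hj := norm_add_smul_pos ht hut (q j)
    have hk := norm_add_smul_pos ht hut (q k)
    rw [Set.disjoint_left, ← Set.image_mul_left_Ioo hj, ← Set.image_mul_left_Icc hk.le (hac k),
      Set.image_image, Set.image_image]
    simp only [linePath_graph ht hut]
    rintro _ ⟨x, hx, rfl⟩ ⟨y, hy, hxy⟩
    have h1 := congrArg (inner ℝ t) hxy
    have h2 := congrArg (inner ℝ u) hxy
    simp only [inner_graph_left ht hut] at h1
    simp only [inner_graph_right hu hut] at h2
    subst h1
    exact hdis j k hjk y hx hy h2.symm

variable (ht : ‖t‖ = 1) (hu : ‖u‖ = 1) (hut : inner ℝ t u = 0)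
    (p q a c : ι → ℝ) (θ : ι → Fin m → ℤ) (hac : ∀ j, a j ≤ c j)
    (hdis : ∀ j k, j ≠ k → ∀ x ∈ Set.Ioo (a j) (c j), x ∈ Set.Icc (a k) (c k) →
      p j + q j * x ≠ p k + q k * x)

theorem graphFamily_seg (j : ι) : (graphFamily ht hu hut p q a c θ hac hdis).seg j =
    (fun x : ℝ => x • t + (p j + q j * x) • u) '' Set.Ioo (a j) (c j) := by
  have hj := norm_add_smul_pos ht hut (q j)
  change linePath _ _ '' Set.Ioo (‖t + q j • u‖ * a j) (‖t + q j • u‖ * c j) = _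
  rw [← Set.image_mul_left_Ioo hj, Set.image_image]
  exact Set.image_congr fun x _ => linePath_graph ht hut _ _ x

end GraphFamily

/-! ### The tent construction and the upper bound -/

section Tents

variable {N : ℕ}

/-- The height at `0` of the affine functions of the tent family: the two ends of the line, and
the two sides of `N` tents of slopes `k ε` over `(-(1/2 - ε), 1/2 - ε)`. -/
noncomputable def tentHeight (ε : ℝ) : Bool ⊕ (Fin N × Bool) → ℝ
  | .inl _ => 0
  | .inr (k, _) => k * ε * (1 / 2 - ε)

/-- The slopes of the affine functions of the tent family. -/
noncomputable def tentSlope (ε : ℝ) : Bool ⊕ (Fin N × Bool) → ℝ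
  | .inl _ => 0
  | .inr (k, false) => k * ε
  | .inr (k, true) => -(k * ε)

/-- The left end points of the intervals of the tent family. -/
noncomputable def tentLo (ε : ℝ) : Bool ⊕ (Fin N × Bool) → ℝ
  | .inl false => -(1 / 2)
  | .inl true => 1 / 2 - ε
  | .inr (_, false) => -(1 / 2 - ε)
  | .inr (_, true) => 0

/-- The right end points of the intervals of the tent family. -/
noncomputable def tentHi (ε : ℝ) : Bool ⊕ (Fin N × Bool) → ℝ
  | .inl false => -(1 / 2 - ε)
  | .inl true => 1 / 2
  | .inr (_, false) => 0
  | .inr (_, true) => 1 / 2 - ε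

/-- The multiplicities of the tent family. -/
def tentMult {m : ℕ} (b s : Fin m → ℤ) : Bool ⊕ (Fin N × Bool) → Fin m → ℤ
  | .inl _ => b
  | .inr _ => s

theorem tentLo_le_tentHi {ε : ℝ} (h0 : 0 < ε) (h1 : ε < 1 / 2) (j : Bool ⊕ (Fin N × Bool)) :
    tentLo ε j ≤ tentHi ε j := by
  rcases j with (_ | _) | ⟨k, (_ | _)⟩ <;> simp only [tentLo, tentHi] <;> linarith

theorem tent_disjoint {ε : ℝ} (h0 : 0 < ε) (h1 : ε < 1 / 2) (j k : Bool ⊕ (Fin N × Bool))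
    (hjk : j ≠ k) (x : ℝ) (hx : x ∈ Set.Ioo (tentLo ε j) (tentHi ε j))
    (hx' : x ∈ Set.Icc (tentLo ε k) (tentHi ε k)) :
    tentHeight ε j + tentSlope ε j * x ≠ tentHeight ε k + tentSlope ε k * x := by
  rcases j with (_ | _) | ⟨j, (_ | _)⟩ <;> rcases k with (_ | _) | ⟨k, (_ | _)⟩ <;>
    simp only [tentLo, tentHi, tentHeight, tentSlope, Set.mem_Ioo, Set.mem_Icc] at hx hx' ⊢ <;>
    first
    | exact absurd rfl hjk
    | (exfalso; linarith [hx.1, hx.2, hx'.1, hx'.2])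
    | skip
  -- Only two tents over the same half remain. Their heights differ by `(j - k) ε (1/2 - ε - |x|)`,
  -- whose last factor is positive inside the interval.
  · intro h
    have hne : ε * (1 / 2 - ε + x) ≠ 0 := (mul_pos h0 (by linarith)).ne'
    have : (j : ℝ) = k := mul_right_cancel₀ hne (by linear_combination h)
    exact hjk (by rw [Fin.ext (Nat.cast_injective this)])
  · intro h
    have hne : ε * (1 / 2 - ε - x) ≠ 0 := (mul_pos h0 (by linarith)).ne'
    have : (j : ℝ) = k := mul_right_cancel₀ hne (by linear_combination h)
    exact hjk (by rw [Fin.ext (Nat.cast_injective this)])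

variable {m n : ℕ} {t u : EuclideanSpace ℝ (Fin n)}

/-- The line `ℝ t` with multiplicity `b` near the boundary of the ball of radius `1/2`, split into
`N` tents with multiplicity `s` in between. -/
noncomputable def tentFamily (N : ℕ) (ht : ‖t‖ = 1) (hu : ‖u‖ = 1) (hut : inner ℝ t u = 0)
    (b s : Fin m → ℤ) {ε : ℝ} (h0 : 0 < ε) (h1 : ε < 1 / 2) :
    SegmentFamily (Bool ⊕ (Fin N × Bool)) m n :=
  graphFamily ht hu hut (tentHeight ε) (tentSlope ε) (tentLo ε) (tentHi ε) (tentMult b s)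
    (tentLo_le_tentHi h0 h1) (tent_disjoint h0 h1)

variable (ht : ‖t‖ = 1) (hu : ‖u‖ = 1) (hut : inner ℝ t u = 0) {b s : Fin m → ℤ} {ε : ℝ}
  (h0 : 0 < ε) (h1 : ε < 1 / 2)

/-- Slopes at most 1 suffice: with `d = 1/2 - ε`, the norm is at most `|x| + kε (d - |x|) ≤ d`. -/
theorem tentFamily_seg_inr_subset (hN : N * ε ≤ 1) (k : Fin N × Bool) :
    (tentFamily N ht hu hut b s h0 h1).seg (.inr k) ⊆ Metric.closedBall 0 (1 / 2 - ε) := by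
  rw [tentFamily, graphFamily_seg]
  rintro _ ⟨x, hx, rfl⟩
  rw [mem_closedBall_zero_iff]
  refine (norm_add_le _ _).trans ?_
  rw [norm_smul, norm_smul, ht, hu, mul_one, mul_one, Real.norm_eq_abs, Real.norm_eq_abs]
  obtain ⟨k, σ⟩ := k
  have hk0 : 0 ≤ (k : ℝ) * ε := by positivity
  have hk1 : (k : ℝ) * ε ≤ 1 :=
    (mul_le_mul_of_nonneg_right (Nat.cast_le.2 k.2.le) h0.le).trans hN
  cases σ <;> simp only [tentLo, tentHi, tentHeight, tentSlope, Set.mem_Ioo] at hx ⊢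
  · rw [abs_of_neg hx.2, ← mul_add,
      abs_of_nonneg (mul_nonneg hk0 (by linarith))]
    linarith [mul_le_of_le_one_left (show 0 ≤ 1 / 2 - ε + x by linarith) hk1]
  · rw [abs_of_pos hx.1, neg_mul, ← sub_eq_add_neg, ← mul_sub,
      abs_of_nonneg (mul_nonneg hk0 (by linarith))]
    linarith [mul_le_of_le_one_left (show 0 ≤ 1 / 2 - ε - x by linarith) hk1]

theorem tentFamily_seg_inl (σ : Bool) :
    (tentFamily N ht hu hut b s h0 h1).seg (.inl σ) =
      linePath 0 t '' Set.Ioo (tentLo (N := N) ε (.inl σ)) (tentHi (N := N) ε (.inl σ)) := by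
  rw [tentFamily, graphFamily_seg]
  refine Set.image_congr fun x _ => ?_
  simp [tentHeight, tentSlope, linePath]

theorem tentFamily_seg_subset_ball (hN : N * ε ≤ 1) (j : Bool ⊕ (Fin N × Bool)) :
    (tentFamily N ht hu hut b s h0 h1).seg j ⊆ Metric.ball 0 (1 / 2) := by
  rcases j with σ | k
  · rw [tentFamily_seg_inl]
    refine Set.Subset.trans (Set.image_mono ?_)
      ((span_inter_ball_eq_linePath_image ht (1 / 2)).symm.subset.trans Set.inter_subset_right)
    cases σ
    · exact Set.Ioo_subset_Ioo le_rfl (by simp only [tentHi]; linarith)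
    · exact Set.Ioo_subset_Ioo (by simp only [tentLo]; linarith) le_rfl
  · exact (tentFamily_seg_inr_subset ht hu hut h0 h1 hN k).trans
      (Metric.closedBall_subset_ball (by linarith))

theorem vectorSupport_tentFamily_subset (hN : N * ε ≤ 1) :
    vectorSupport (((tentFamily N ht hu hut b s h0 h1).toRectCurrent
        (tentFamily_seg_subset_ball ht hu hut h0 h1 hN)).toMeasure - tensorMeasure
      ((Submodule.span ℝ {t} : Set (EuclideanSpace ℝ (Fin n))) ∩ Metric.ball 0 (1 / 2))
      (fun _ => b) (fun _ => t)) ⊆ Metric.closedBall 0 (1 / 2 - ε) := by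
  have hL := span_inter_ball_eq_linePath_image ht (1 / 2)
  refine SegmentFamily.vectorSupport_toMeasure_sub_subset _ _ Metric.isClosed_closedBall
    (hL ▸ measurableSet_linePath_image 0 ht measurableSet_Ioo) ?_ ?_ ?_
  · rw [hL, hausdorffMeasure_linePath_image 0 ht, Real.volume_Ioo]
    exact ENNReal.ofReal_ne_top
  · rw [hL]
    rintro _ ⟨⟨x, hx, rfl⟩, hxK⟩
    rw [mem_closedBall_zero_iff] at hxK
    simp only [linePath, zero_add, norm_smul, ht, mul_one, Real.norm_eq_abs, not_le] at hxK
    rcases lt_abs.1 hxK with h | h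
    · exact Set.mem_iUnion.2 ⟨.inl true, by
        rw [tentFamily_seg_inl]; exact ⟨x, ⟨h, hx.2⟩, rfl⟩⟩
    · exact Set.mem_iUnion.2 ⟨.inl false, by
        rw [tentFamily_seg_inl]; exact ⟨x, ⟨hx.1, by simp only [tentHi]; linarith⟩, rfl⟩⟩
  · rintro (σ | k) x hx hxK
    · refine ⟨?_, rfl, ?_⟩
      · rw [tentFamily_seg_inl] at hx
        rw [hL]
        refine Set.image_mono ?_ hx
        cases σ
        · exact Set.Ioo_subset_Ioo le_rfl (by simp only [tentHi]; linarith)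
        · exact Set.Ioo_subset_Ioo (by simp only [tentLo]; linarith) le_rfl
      · simp [tentFamily, graphFamily, tentSlope, ht]
    · exact absurd (tentFamily_seg_inr_subset ht hu hut h0 h1 hN k hx) hxK

/-- At each apex the two sides of a tent cancel; at `±(1/2 - ε) t` the `N` tents of multiplicity `s`
balance the end of multiplicity `N s`; at `±t/2` the test function vanishes. -/
theorem divFree_tentFamily (hN : N * ε ≤ 1) (hb : b = N • s) :
    ((tentFamily N ht hu hut b s h0 h1).toRectCurrent
        (tentFamily_seg_subset_ball ht hu hut h0 h1 hN)).DivFree := by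
  refine SegmentFamily.divFree_toRectCurrent _ _ fun ζ hζ i => ?_
  have hend : ∀ r : ℝ, |r| = 1 / 2 → ζ (r • t) = 0 := fun r hr => by
    refine image_eq_zero_of_notMem_tsupport fun hmem => ?_
    have := mem_ball_zero_iff.1 (hζ hmem)
    rw [norm_smul, ht, Real.norm_eq_abs, hr, mul_one] at this
    exact lt_irrefl _ this
  have hp := hend (1 / 2) (by norm_num)
  have hm := hend (-(1 / 2)) (by norm_num)
  have hbi : (b i : ℝ) = N * s i := by simp [hb]
  simp only [tentFamily, graphFamily, linePath_graph ht hut, Fintype.sum_sum_type,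
    Fintype.sum_prod_type, Fintype.sum_bool, tentHeight, tentSlope, tentLo, tentHi, tentMult,
    zero_mul, zero_smul, add_zero, mul_zero]
  -- All tents have height 0 at both feet.
  have hside : ∀ k : Fin N, (k : ℝ) * ε * (1 / 2 - ε) + -(k * ε) * (1 / 2 - ε) = 0 ∧
      (k : ℝ) * ε * (1 / 2 - ε) + k * ε * -(1 / 2 - ε) = 0 := fun k => ⟨by ring, by ring⟩
  simp only [(hside _).1, (hside _).2, zero_smul, add_zero, hp, hm, hbi]
  rw [Finset.sum_congr rfl fun k _ => show _ = (s i : ℝ) * (ζ ((1 / 2 - ε) • t) -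
    ζ (-(1 / 2 - ε) • t)) by ring, Finset.sum_const, Finset.card_univ, Fintype.card_fin,
    nsmul_eq_mul]
  ring

/-- Splitting a line of multiplicity `N s` into `N` lines of multiplicity `s`. -/
theorem hOneEnvelope_nsmul_le (hu : ‖u‖ = 1) (hut : inner ℝ t u = 0) (ht : ‖t‖ = 1)
    {ψ : (Fin m → ℤ) → EuclideanSpace ℝ (Fin n) → ℝ} (hψ0 : ∀ b x, 0 ≤ ψ b x)
    (hψ : ∀ b, Continuous (ψ b)) (N : ℕ) (s : Fin m → ℤ) :
    hOneEnvelope ψ (N • s) t ≤ ENNReal.ofReal (N * ψ s t) := by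
  let e : ℝ → Bool ⊕ (Fin N × Bool) → ℝ≥0∞ := fun ε j => ENNReal.ofReal
    (ψ (tentMult (N • s) s j) (‖t + tentSlope ε j • u‖⁻¹ • (t + tentSlope ε j • u)) *
      (‖t + tentSlope ε j • u‖ * (tentHi ε j - tentLo ε j)))
  have hle : ∀ᶠ ε in 𝓝[>] (0 : ℝ), hOneEnvelope ψ (N • s) t ≤ ∑ j, e ε j := by
    have hN : ∀ᶠ ε : ℝ in 𝓝[>] (0 : ℝ), (N : ℝ) * ε ≤ 1 := by
      have : Tendsto (fun ε : ℝ => N * ε) (𝓝[>] (0 : ℝ)) (𝓝 0) := by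
        have h := (continuous_const_mul (N : ℝ)).tendsto 0
        rw [mul_zero] at h
        exact h.mono_left nhdsWithin_le_nhds
      exact this.eventually_le_const one_pos
    filter_upwards [hN, Ioo_mem_nhdsGT (show (0 : ℝ) < 1 / 2 by norm_num)] with ε hN ⟨h0, h1⟩
    refine (iInf₂_le_of_le ((tentFamily N ht hu hut (N • s) s h0 h1).toRectCurrent
      (tentFamily_seg_subset_ball ht hu hut h0 h1 hN))
      (divFree_tentFamily ht hu hut h0 h1 hN rfl) (iInf_le_of_le
        ((vectorSupport_tentFamily_subset ht hu hut h0 h1 hN).trans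
          (Metric.closedBall_subset_ball (by linarith))) ?_))
    rw [SegmentFamily.energy_toRectCurrent]
    refine Finset.sum_le_sum fun j _ => ?_
    rw [← ENNReal.ofReal_mul (hψ0 _ _)]
    simp only [e, tentFamily, graphFamily, mul_sub, le_refl]
  have hslope : ∀ j : Bool ⊕ (Fin N × Bool), Continuous (fun ε => tentSlope ε j) ∧
      tentSlope 0 j = 0 := by
    rintro (_ | ⟨k, (_ | _)⟩) <;> simp only [tentSlope] <;>
      exact ⟨by fun_prop, by simp⟩
  have hlen : ∀ j : Bool ⊕ (Fin N × Bool), Continuous (fun ε => tentHi ε j - tentLo ε j) := by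
    rintro ((_ | _) | ⟨k, (_ | _)⟩) <;> simp only [tentHi, tentLo] <;> fun_prop
  -- The energy formula also makes sense at `ε = 0`, where all slopes vanish, and is continuous
  -- there.
  have hlim : Tendsto (fun ε => ∑ j, e ε j) (𝓝[>] 0) (𝓝 (∑ j, e 0 j)) := by
    refine tendsto_finsetSum _ fun j _ => ?_
    refine ((ENNReal.continuous_ofReal.continuousAt).comp ?_).tendsto.mono_left nhdsWithin_le_nhds
    have hw : Continuous fun ε => t + tentSlope ε j • u :=
      continuous_const.add ((hslope j).1.smul continuous_const)
    have hne : ‖t + tentSlope 0 j • u‖ ≠ 0 := (norm_add_smul_pos ht hut _).ne'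
    exact ((hψ _).continuousAt.comp
      ((hw.norm.continuousAt.inv₀ hne).smul hw.continuousAt)).mul
      (hw.norm.continuousAt.mul (hlen j).continuousAt)
  refine (ge_of_tendsto hlim hle).trans_eq ?_
  have hpos : 0 ≤ ψ s t * 2⁻¹ := mul_nonneg (hψ0 _ _) (by norm_num)
  -- At `ε = 0` the two ends have length 0 and each of the `2 N` tent sides contributes `ψ s t / 2`.
  simp only [e, (hslope _).2, zero_smul, add_zero, ht, inv_one, one_smul, one_mul,
    Fintype.sum_sum_type, Fintype.sum_prod_type, Fintype.sum_bool, tentHi, tentLo, tentMult]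
  simp only [sub_zero, sub_neg_eq_add, zero_add, sub_self, mul_zero,
    ENNReal.ofReal_zero, one_div, Finset.sum_const, Finset.card_univ, Fintype.card_fin,
    nsmul_eq_mul]
  rw [← ENNReal.ofReal_add hpos hpos, ← ENNReal.ofReal_natCast N,
    ← ENNReal.ofReal_mul (Nat.cast_nonneg N)]
  congr 1
  ring

end Tents

/-! ### Conclusion -/

theorem exists_unit_orthogonal {n : ℕ} (hn : 2 ≤ n) (t : EuclideanSpace ℝ (Fin n)) :
    ∃ u : EuclideanSpace ℝ (Fin n), ‖u‖ = 1 ∧ inner ℝ t u = 0 := by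
  have h1 := Submodule.finrank_add_finrank_orthogonal (Submodule.span ℝ {t})
  have h2 : Module.finrank ℝ (Submodule.span ℝ {t}) ≤ 1 := by
    simpa using finrank_span_le_card (R := ℝ) ({t} : Set (EuclideanSpace ℝ (Fin n)))
  rw [finrank_euclideanSpace_fin] at h1
  have hne : (Submodule.span ℝ {t})ᗮ ≠ ⊥ := fun h => by
    rw [h, finrank_bot] at h1
    omega
  obtain ⟨w, hw, hw0⟩ := Submodule.exists_mem_ne_zero_of_ne_bot hne
  refine ⟨‖w‖⁻¹ • w, norm_smul_inv_norm hw0, ?_⟩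
  rw [inner_smul_right, Submodule.mem_orthogonal_singleton_iff_inner_right.1 hw, mul_zero]

theorem continuous_cubicDensity {n : ℕ} (η : ℝ) (b : Fin n → ℤ) :
    Continuous (cubicDensity η b) := by
  unfold cubicDensity; fun_prop

theorem lemma4p3 (n : ℕ) (hn2 : 2 ≤ n) (hn9 : n ≤ 9) (η : ℝ) (hη0 : 0 ≤ η) (hη1 : η ≤ 1)
    (i : Fin n) (β : ℤ) (t : EuclideanSpace ℝ (Fin n)) (ht : ‖t‖ = 1) :
    hOneEnvelope (cubicDensity η) (β • (Pi.single i 1 : Fin n → ℤ)) t =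
      ENNReal.ofReal (|(β : ℝ)| * cubicDensity η (Pi.single i 1) t) := by
  have hdens := cubicDensity_single η i 1 t
  rw [one_smul, Int.cast_one, one_pow, one_mul] at hdens
  refine le_antisymm ?_ ?_
  · obtain ⟨u, hu, hut⟩ := exists_unit_orthogonal hn2 t
    -- The number of tents is `|β|`, each carrying `sign β · e_i`, and the density is even in the
    -- multiplicity. For `β = 0` there are no tents and both sides vanish.
    have hβ : β • (Pi.single i 1 : Fin n → ℤ) =
        β.natAbs • (β.sign • (Pi.single i 1 : Fin n → ℤ)) := by
      rw [← natCast_zsmul, smul_smul, mul_comm, Int.sign_mul_natAbs]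
    have hval : (β.natAbs : ℝ) * cubicDensity η (β.sign • (Pi.single i 1 : Fin n → ℤ)) t =
        |(β : ℝ)| * cubicDensity η (Pi.single i 1) t := by
      rw [cubicDensity_single, hdens, Nat.cast_natAbs, Int.cast_abs]
      rcases eq_or_ne β 0 with rfl | h
      · simp
      · have : (β.sign : ℝ) ^ 2 = 1 := by
          rcases h.lt_or_gt with h | h
          · simp [Int.sign_eq_neg_one_of_neg h]
          · simp [Int.sign_eq_one_of_pos h]
        rw [this, one_mul]
    rw [hβ, ← hval]
    exact hOneEnvelope_nsmul_le hu hut ht (cubicDensity_nonneg hη0) (continuous_cubicDensity η) _ _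
  · have h := le_hOneEnvelope_cubicDensity hη0 hη1 i (β • (Pi.single i 1 : Fin n → ℤ)) ht
    rw [hdens]
    simpa using h
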